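/- **Theorem (Extended Objective Perturbation).** Let $\mathcal X$ be any set, $n\ge 1$, $m\ge 0$, $\epsilon>0$, $0<q<1$, $\Delta>0$, $\lambda>0$. Let $\Theta\subseteq\mathbb R^m$ be convex, $r:\Theta\to\mathbb R$ convex, and let $\ell(\theta;x)$ ($\theta\in\Theta$, $x\in\mathcal X$) be a loss such that $\hat{L}(\theta;X)=\frac1n\sum_{i=1}^n\ell(\theta;x_i)$ is convex in $\theta\in\Theta$ for every database $X=(x_1,\dots,x_n)\in\mathcal X^n$, and such that, for every $x$, $\ell(\cdot;x)$ is twice differentiable on $\Theta$ (derivatives being taken within $\Theta$) with gradient $\nabla\ell(\theta;x)$ and symmetric Hessian $\nabla^2\ell(\theta;x)$ continuous in $\theta\in\Theta$. (If $\Theta$ has empty interior, $\nabla\ell$ and $\nabla^2\ell$ denote any fixed choice of such derivatives.) Assume that for all $\theta\in\Theta$ and $x,x'\in\mathcal X$: * $\nabla^2\ell(\theta;x)$ has rank at most one, and all its eigenvalues are at most $\lambda$; * $\|\nabla\ell(\theta;x)-\nabla\ell(\theta;x')\|_K\le\Delta$, where $\|\cdot\|_K$ is a given (arbitrary) norm on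 $\mathbb R^m$. Set $\gamma=\dfrac{\lambda}{\exp(\epsilon(1-q))-1}$, let $V$ be a random vector in $\mathbb R^m$ with density proportional to $\exp\!\big(-\frac{\epsilon q}{\Delta}\|v\|_K\big)$, and for $X\in\mathcal X^n$ consider $$\theta_{DP}(X)=\operatorname*{arg\,min}_{\theta\in\Theta}\ \hat{L}(\theta;X)+\frac1n r(\theta)+\frac{\gamma}{2n}\theta^\top\theta+\frac1n V^\top\theta .$$ 1. If $\Theta$ is closed and nonempty and $r$ is lower semicontinuous on $\Theta$, then for every $X$ and every value of $V$ the minimizer exists and is unique. 2. Whenever, for every $X\in\mathcal X^n$, a minimizer exists almost surely (in particular in case 1), $\theta_{DP}(X)$ is a random vector (measurable up to a null set) and the mechanism $X\mapsto\theta_{DP}(X)$ satisfies $\epsilon$-differential privacy: for all $X,X'\in\mathcal X^n$ that differ in exactly one entry and all Borel sets $B\subseteq\mathbb R^m$, $$P(\theta_{DP}(X')\in B)\le e^{\epsilon}\,P(\theta_{DP}(X)\in B).$$ -/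

import Mathlib

open scoped RealInnerProductSpace
open MeasureTheory

noncomputable section

/-- `g` is a gradient field and `H` a symmetric Hessian field, continuous on `Θ`, of the function
`f` on `Θ`. Since `f` only has to be defined on `Θ`, all derivatives are taken within `Θ`. If `Θ`
is convex with nonempty interior, then `g` and `H` are determined on `Θ` by `f`; if `f` is of class
`C²` on an open set that contains `Θ`, then its usual gradient and Hessian qualify. -/
structure HasGradientHessianOn {m : ℕ} (f : EuclideanSpace ℝ (Fin m) → ℝ)
    (g : EuclideanSpace ℝ (Fin m) → EuclideanSpace ℝ (Fin m))
    (H : EuclideanSpace ℝ (Fin m) → EuclideanSpace ℝ (Fin m) →L[ℝ] EuclideanSpace ℝ (Fin m))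
    (Θ : Set (EuclideanSpace ℝ (Fin m))) : Prop where
  hasGradient : ∀ θ ∈ Θ, HasGradientWithinAt f (g θ) Θ θ
  hasHessian : ∀ θ ∈ Θ, HasFDerivWithinAt g (H θ) Θ θ
  symmetric : ∀ θ ∈ Θ, (H θ).toLinearMap.IsSymmetric
  continuousOn : ContinuousOn H Θ

/-- The empirical loss `L(θ; X) = (1/n) ∑ᵢ ℓ(θ; xᵢ)`. -/
def empiricalLoss {𝒳 : Type*} {m n : ℕ} (ℓ : EuclideanSpace ℝ (Fin m) → 𝒳 → ℝ)
    (X : Fin n → 𝒳) (θ : EuclideanSpace ℝ (Fin m)) : ℝ :=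
  (1 / (n : ℝ)) * ∑ i, ℓ θ (X i)

/-- The perturbed objective
`θ ↦ L(θ; X) + (1/n) r(θ) + (γ/(2n)) θᵀθ + (1/n) Vᵀθ`. -/
def perturbedObjective {𝒳 : Type*} {m n : ℕ} (ℓ : EuclideanSpace ℝ (Fin m) → 𝒳 → ℝ)
    (r : EuclideanSpace ℝ (Fin m) → ℝ) (γ : ℝ) (X : Fin n → 𝒳)
    (V θ : EuclideanSpace ℝ (Fin m)) : ℝ :=
  empiricalLoss ℓ X θ + (1 / (n : ℝ)) * r θ + γ / (2 * (n : ℝ)) * ⟪θ, θ⟫ + ⟪V, θ⟫ / (n : ℝ)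

/-- `θ` belongs to `arg min_{Θ} f`. -/
def IsArgMin {m : ℕ} (f : EuclideanSpace ℝ (Fin m) → ℝ) (Θ : Set (EuclideanSpace ℝ (Fin m)))
    (θ : EuclideanSpace ℝ (Fin m)) : Prop :=
  θ ∈ Θ ∧ IsMinOn f Θ θ

/-- The measure on `ℝᵐ` with Lebesgue density `v ↦ exp (-a ‖v‖_K)`. -/
def kNormUnnormalized {m : ℕ} (K : Seminorm ℝ (EuclideanSpace ℝ (Fin m))) (a : ℝ) :
    Measure (EuclideanSpace ℝ (Fin m)) :=
  volume.withDensity fun v => ENNReal.ofReal (Real.exp (-(a * K v)))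

/-- The `K`-norm noise: the law on `ℝᵐ` with density proportional to `exp (-a ‖v‖_K)`. -/
def kNormNoise {m : ℕ} (K : Seminorm ℝ (EuclideanSpace ℝ (Fin m))) (a : ℝ) :
    Measure (EuclideanSpace ℝ (Fin m)) :=
  (kNormUnnormalized K a Set.univ)⁻¹ • kNormUnnormalized K a

open Classical in
/-- `ε`-differential privacy of a mechanism, given by the law `M X` of its output on every database
`X`: databases at Hamming distance one have output probabilities within a factor `exp ε`. -/
def IsDifferentiallyPrivate {𝒳 𝒴 : Type*} [MeasurableSpace 𝒴] {n : ℕ} (ε : ℝ)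
    (M : (Fin n → 𝒳) → Measure 𝒴) : Prop :=
  (∀ X, IsProbabilityMeasure (M X)) ∧
  ∀ X X' : Fin n → 𝒳, hammingDist X X' = 1 →
    ∀ B : Set 𝒴, MeasurableSet B → M X' B ≤ ENNReal.ofReal (Real.exp ε) * M X B

end

/-! Let `X` and `X'` differ only in entry `i`, and let `T X' V` be the minimizer for `X'` under
noise `V`. The first-order condition involves the data and the noise only through `∑ g + V`, so `Ψ V
= V + g (X' i) θ - g (X i) θ` with `θ = T X' V` is a noise for which `X` has the same minimizer `θ`.
By uniqueness of minimizers `Ψ` is injective, and the claim becomes a change of variables. The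
density costs a factor `exp (-ε q)`, since `Ψ` moves points by at most `Δ` in `K`
(`kNormUnnormalized_le_image`). The Jacobian is at least `γ / (lam + γ) = exp (-ε (1 - q))`, which
is why `γ` has its value. For the Jacobian, `T X'` is `γ⁻¹`-Lipschitz by strong monotonicity, hence
differentiable almost everywhere. Its derivative `N` is symmetric because `T X'` is a supergradient
field of the optimal value, which is concave in the noise
(`LipschitzWith.isSymmetric_of_supergradient`). Differentiating strong monotonicity bounds `N`, and
`le_det_of_rank_one_sub_rank_one` concludes. Working with `V ↦ θ`, not its inverse, requires no
smoothness of `r` and no interior of `Θ`. -/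

/-! ### Determinants of rank-two perturbations of the identity. -/

section LinearAlgebra

open Module

variable {E : Type*} [NormedAddCommGroup E] [InnerProductSpace ℝ E] [FiniteDimensional ℝ E]

/-- A symmetric operator of rank at most one is `h ↦ μ ⟪u, h⟫ u` with `‖u‖ ≤ 1`, where `μ` is zero or
an eigenvalue. -/
lemma LinearMap.IsSymmetric.exists_eq_smul_of_finrank_range_le_one {A : E →ₗ[ℝ] E}
    (hA : A.IsSymmetric) (hr : finrank ℝ (LinearMap.range A) ≤ 1) :
    ∃ (μ : ℝ) (u : E), ‖u‖ ≤ 1 ∧ (∀ h, A h = (μ * ⟪u, h⟫) • u) ∧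
      (μ = 0 ∨ Module.End.HasEigenvalue A μ) := by
  by_cases h0 : A = 0
  · exact ⟨0, 0, by simp, by simp [h0], Or.inl rfl⟩
  obtain ⟨⟨w, hw⟩, hspan⟩ := finrank_le_one_iff.1 hr
  have hspan' : ∀ h, ∃ c : ℝ, A h = c • w := fun h => by
    obtain ⟨c, hc⟩ := hspan ⟨A h, LinearMap.mem_range_self A h⟩
    exact ⟨c, by simpa using (congrArg Subtype.val hc).symm⟩
  have hw0 : w ≠ 0 := by
    rintro rfl
    refine h0 (LinearMap.ext fun h => ?_)
    obtain ⟨c, hc⟩ := hspan' h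
    simp [hc]
  obtain ⟨μ, hμ⟩ := hspan' w
  have hn : ‖w‖ ≠ 0 := norm_ne_zero_iff.2 hw0
  refine ⟨μ, ‖w‖⁻¹ • w, ?_, fun h => ?_, Or.inr ?_⟩
  · rw [norm_smul, norm_inv, norm_norm, inv_mul_cancel₀ hn]
  · obtain ⟨c, hc⟩ := hspan' h
    have key : c * ‖w‖ ^ 2 = μ * ⟪w, h⟫ := by
      have := hA h w
      rw [hc, hμ, real_inner_smul_left, real_inner_smul_right, real_inner_self_eq_norm_sq] at this
      rw [this, real_inner_comm]
    rw [hc, real_inner_smul_left, smul_smul]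
    congr 1
    field_simp
    linarith
  · exact Module.End.hasEigenvalue_of_hasEigenvector (x := w)
      (Module.End.hasEigenvector_iff.2 ⟨Module.End.mem_eigenspace_iff.2 hμ, hw0⟩)

/-- The determinant of a perturbation of the identity by an operator of rank two. -/
lemma LinearMap.det_of_eq_add_smul_add_smul {A : E →ₗ[ℝ] E} {a b c d : E}
    (hA : ∀ h, A h = h + ⟪a, h⟫ • b + ⟪c, h⟫ • d) :
    LinearMap.det A = (1 + ⟪a, b⟫) * (1 + ⟪c, d⟫) - ⟪a, d⟫ * ⟪c, b⟫ := by
  let e := stdOrthonormalBasis ℝ E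
  let U : Matrix (Fin (finrank ℝ E)) (Fin 2) ℝ := Matrix.of fun i => ![⟪e i, b⟫, ⟪e i, d⟫]
  let W : Matrix (Fin 2) (Fin (finrank ℝ E)) ℝ := Matrix.of ![fun i => ⟪a, e i⟫, fun i => ⟪c, e i⟫]
  have hM : LinearMap.toMatrix e.toBasis e.toBasis A = 1 + U * W := by
    ext i j
    rw [LinearMap.toMatrix_apply]
    simp only [OrthonormalBasis.coe_toBasis, OrthonormalBasis.coe_toBasis_repr_apply,
      OrthonormalBasis.repr_apply_apply, hA, inner_add_right, real_inner_smul_right,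
      Matrix.add_apply, Matrix.mul_apply, Fin.sum_univ_two, U, W, Matrix.of_apply,
      Matrix.cons_val_zero, Matrix.cons_val_one, Matrix.one_apply,
      orthonormal_iff_ite.1 e.orthonormal]
    ring
  -- `det (1 + U W) = det (1 + W U)` reduces to a 2 × 2 determinant, whose entries are inner
  -- products by Parseval.
  rw [← LinearMap.det_toMatrix e.toBasis, hM, Matrix.det_one_add_mul_comm, Matrix.det_fin_two]
  simp only [Matrix.add_apply, Matrix.mul_apply, U, W, Matrix.of_apply,
      Matrix.cons_val_zero, Matrix.cons_val_one, Matrix.one_apply, e.sum_inner_mul_inner]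
  simp

/-- The Jacobian bound behind objective perturbation: if `N` is symmetric and `-N` is dominated by
the inverse of `μ u uᵀ + γ`, the determinant of `1 + (μ u uᵀ - ν v vᵀ) N` is at least
`γ / (lam + γ)`. -/
lemma le_det_of_rank_one_sub_rank_one {A N : E →ₗ[ℝ] E} (hN : N.IsSymmetric) {γ lam μ ν : ℝ}
    (hγ : 0 < γ) (hlam : 0 < lam) (hμ : μ ≤ lam) {u v : E} (hu : ‖u‖ ≤ 1)
    (hμN : ∀ h, 0 ≤ μ * ⟪u, N h⟫ ^ 2) (hνN : ∀ h, 0 ≤ ν * ⟪v, N h⟫ ^ 2)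
    (hbd : ∀ h, μ * ⟪u, N h⟫ ^ 2 + γ * ‖N h‖ ^ 2 ≤ -⟪h, N h⟫)
    (hA : ∀ h, A h = h + (μ * ⟪u, N h⟫) • u - (ν * ⟪v, N h⟫) • v) :
    γ / (lam + γ) ≤ LinearMap.det A := by
  have hdet := LinearMap.det_of_eq_add_smul_add_smul (A := A) (a := μ • N u) (b := u)
    (c := (-ν) • N v) (d := v) (fun h => by
      rw [hA, real_inner_smul_left, real_inner_smul_left, hN, hN, neg_mul, neg_smul,
        ← sub_eq_add_neg])
  simp only [real_inner_smul_left] at hdet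
  have hsym : ⟪N v, u⟫ = ⟪N u, v⟫ := by rw [hN, real_inner_comm]
  rw [hsym] at hdet
  set z := ⟪N u, v⟫ with hz
  obtain ⟨s, hs⟩ : ∃ s, s = -⟪N u, u⟫ := ⟨_, rfl⟩
  obtain ⟨w, hw⟩ : ∃ w, w = -⟪N v, v⟫ := ⟨_, rfl⟩
  have hpos : ∀ h, 0 ≤ -⟪N h, h⟫ := fun h => by
    have := hbd h
    have := hμN h
    rw [real_inner_comm]
    nlinarith [sq_nonneg ‖N h‖]
  have hs0 : 0 ≤ s := hs ▸ hpos u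
  have hw0 : 0 ≤ w := hw ▸ hpos v
  -- `ν` may be negative, but then nonnegativity along the range of `N` forces `w = 0`.
  have hνw : 0 ≤ ν * w := by
    rcases le_or_gt 0 ν with h | h
    · positivity
    · have : ⟪v, N v⟫ ^ 2 = 0 := by nlinarith [hνN v, sq_nonneg ⟪v, N v⟫]
      have : ⟪N v, v⟫ = 0 := by rw [real_inner_comm]; exact pow_eq_zero_iff two_ne_zero |>.1 this
      rw [hw, this]; simp
  have hνμ : 0 ≤ ν * μ * z ^ 2 := by
    have h1 : 0 ≤ ν * z ^ 2 := by simpa [hz, real_inner_comm] using hνN u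
    have h2 : 0 ≤ μ * z ^ 2 := by simpa [← hsym, real_inner_comm] using hμN v
    rcases eq_or_ne z 0 with h | h
    · simp [h]
    · have h3 : 0 < z ^ 2 := by positivity
      have := nonneg_of_mul_nonneg_left h1 h3
      have := nonneg_of_mul_nonneg_left h2 h3
      positivity
  have hμs : μ * s ≤ lam / (lam + γ) := by
    rcases le_or_gt μ 0 with h | h
    · exact (mul_nonpos_of_nonpos_of_nonneg h hs0).trans (by positivity)
    · have h1 := hbd u
      have h2 : s ^ 2 ≤ ‖N u‖ ^ 2 := by
        have : |⟪N u, u⟫| ≤ ‖N u‖ :=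
          (abs_real_inner_le_norm _ _).trans (mul_le_of_le_one_right (norm_nonneg _) hu)
        rw [hs, neg_sq, ← sq_abs]
        gcongr
      rw [real_inner_comm, ← hs, ← sq_abs, ← abs_neg, ← hs, sq_abs] at h1
      rw [le_div_iff₀ (by positivity)]
      rcases hs0.eq_or_lt with h3 | h3
      · rw [← h3]; simp [hlam.le]
      -- `hbd` at `u`, with `s² ≤ ‖N u‖²`, gives `(μ + γ) s² ≤ s`.
      · have h4 : (μ + γ) * s ≤ 1 := by
          have : ((μ + γ) * s) * s ≤ 1 * s := by nlinarith
          exact le_of_mul_le_mul_right this h3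
        nlinarith [mul_le_mul_of_nonneg_left h4 hlam.le,
          mul_nonneg (sub_nonneg.2 hμ) (mul_pos hγ h3).le]
  have h1 : γ / (lam + γ) = 1 - lam / (lam + γ) := by field_simp; ring
  have hdet' : LinearMap.det A = (1 - μ * s) * (1 + ν * w) + ν * μ * z ^ 2 := by
    rw [hdet, hs, hw]; ring
  have h2 : lam / (lam + γ) ≤ 1 := (div_le_one (by positivity)).2 (by linarith)
  rw [hdet', h1]
  nlinarith [mul_nonneg (sub_nonneg.2 (hμs.trans h2)) hνw]

end LinearAlgebra

/-! ### Derivatives within a set and first-order convexity. -/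

section Calculus

open Filter Topology

variable {E F : Type*} [NormedAddCommGroup E] [NormedSpace ℝ E]
  [NormedAddCommGroup F] [InnerProductSpace ℝ F]

/-- Differentiating an inequality between quadratic increments along a dense set. -/
lemma Dense.inner_hasFDerivWithinAt_nonneg {D : Set E} (hD : Dense D) {A B : E → F}
    {A' B' : E →L[ℝ] F} {x : E} (hA : HasFDerivWithinAt A A' D x) (hB : HasFDerivWithinAt B B' D x)
    (h : ∀ y ∈ D, 0 ≤ ⟪A y - A x, B y - B x⟫) (v : E) : 0 ≤ ⟪A' v, B' v⟫ := by
  have hp : ∀ n : ℕ, (0 : ℝ) < 1 / ((n : ℝ) + 1) := fun n => Nat.one_div_pos_of_nat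
  -- The error is quadratic in the step, so the rescaled increments `(n + 1) • (y n - x)` still tend
  -- to `v`.
  have hex : ∀ n : ℕ, ∃ y ∈ D,
      dist (x + (1 / ((n : ℝ) + 1)) • v) y < (1 / ((n : ℝ) + 1)) * (1 / ((n : ℝ) + 1)) :=
    fun n => hD.exists_dist_lt _ (mul_pos (hp n) (hp n))
  choose y hyD hy using hex
  have hlim : Tendsto (fun n : ℕ => ((n : ℝ) + 1) • (y n - x)) atTop (𝓝 v) := by
    rw [tendsto_iff_dist_tendsto_zero]
    refine squeeze_zero (fun _ => dist_nonneg) (fun n => ?_) tendsto_one_div_add_atTop_nhds_zero_nat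
    have hn : (0 : ℝ) < n + 1 := by positivity
    have : ((n : ℝ) + 1) • (y n - x) - v
        = ((n : ℝ) + 1) • (y n - (x + (1 / ((n : ℝ) + 1)) • v)) := by
      rw [← sub_sub, smul_sub _ (y n - x), smul_smul, mul_one_div_cancel hn.ne', one_smul]
    rw [dist_eq_norm, this, norm_smul, ← dist_eq_norm, dist_comm, Real.norm_of_nonneg hn.le]
    calc ((n : ℝ) + 1) * _ ≤ ((n : ℝ) + 1) * ((1 / ((n : ℝ) + 1)) * (1 / ((n : ℝ) + 1))) := by
          gcongr; exact (hy n).le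
      _ = 1 / ((n : ℝ) + 1) := by field_simp
  have hd0 : Tendsto (fun n : ℕ => y n - x) atTop (𝓝 0) := by
    have := (tendsto_one_div_add_atTop_nhds_zero_nat (𝕜 := ℝ)).smul hlim
    rw [zero_smul] at this
    refine this.congr fun n => ?_
    rw [smul_smul, one_div_mul_cancel (by positivity), one_smul]
  have hmem : ∀ᶠ n : ℕ in atTop, x + (y n - x) ∈ D := .of_forall fun n => by simpa using hyD n
  have hlA := hA.lim hd0 hmem hlim
  have hlB := hB.lim hd0 hmem hlim
  refine ge_of_tendsto' (hlA.inner (𝕜 := ℝ) hlB) fun n => ?_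
  rw [real_inner_smul_left, real_inner_smul_right]
  have := h (y n) (hyD n)
  simp only [add_sub_cancel]
  positivity

lemma ConvexOn.map_add_smul_sub_le {Θ : Set F} {f : F → ℝ} (hf : ConvexOn ℝ Θ f) {θ θ' : F}
    (hθ : θ ∈ Θ) (hθ' : θ' ∈ Θ) {t : ℝ} (ht0 : 0 ≤ t) (ht1 : t ≤ 1) :
    f (θ + t • (θ' - θ)) ≤ f θ + t * (f θ' - f θ) := by
  have := hf.2 hθ hθ' (sub_nonneg.2 ht1) ht0 (by ring)
  rw [show (1 - t) • θ + t • θ' = θ + t • (θ' - θ) by module] at this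
  simp only [smul_eq_mul] at this
  linarith

variable [CompleteSpace F]

/-- One-sided directional derivative of a function with a gradient within a convex set. -/
lemma HasGradientWithinAt.tendsto_slope {Θ : Set F} (hΘ : Convex ℝ Θ) {f : F → ℝ} {v θ θ' : F}
    (hf : HasGradientWithinAt f v Θ θ) (hθ : θ ∈ Θ) (hθ' : θ' ∈ Θ) :
    Tendsto (fun t : ℝ => t⁻¹ * (f (θ + t • (θ' - θ)) - f θ)) (𝓝[>] 0) (𝓝 ⟪v, θ' - θ⟫) := by
  have h0 : Tendsto (fun t : ℝ => t) (𝓝[>] 0) (𝓝 0) := tendsto_id.mono_left nhdsWithin_le_nhds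
  have hd : Tendsto (fun t : ℝ => t • (θ' - θ)) (𝓝[>] 0) (𝓝 0) := by
    simpa using h0.smul_const (θ' - θ)
  have := hf.hasFDerivWithinAt.lim (c := fun t : ℝ => t⁻¹) (v := θ' - θ) hd ?_ ?_
  · simpa using this
  · filter_upwards [Ioo_mem_nhdsGT (zero_lt_one (α := ℝ))] with t ht
    exact hΘ.add_smul_sub_mem hθ hθ' ⟨ht.1.le, ht.2.le⟩
  · refine tendsto_const_nhds.congr' ?_
    filter_upwards [self_mem_nhdsWithin] with t ht
    rw [smul_smul, inv_mul_cancel₀ (ne_of_gt ht), one_smul]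

/-- The gradient inequality. -/
lemma ConvexOn.inner_gradientWithin_le {Θ : Set F} {f : F → ℝ} (hf : ConvexOn ℝ Θ f) {v θ θ' : F}
    (hv : HasGradientWithinAt f v Θ θ) (hθ : θ ∈ Θ) (hθ' : θ' ∈ Θ) :
    ⟪v, θ' - θ⟫ ≤ f θ' - f θ := by
  refine le_of_tendsto (hv.tendsto_slope hf.1 hθ hθ') ?_
  filter_upwards [Ioo_mem_nhdsGT (zero_lt_one (α := ℝ))] with t ht
  have := hf.map_add_smul_sub_le hθ hθ' ht.1.le ht.2.le
  rw [inv_mul_le_iff₀ ht.1]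
  linarith

/-- The gradient of a convex function is monotone. -/
lemma ConvexOn.inner_gradientWithin_sub_nonneg {Θ : Set F} {f : F → ℝ} (hf : ConvexOn ℝ Θ f)
    {v v' θ θ' : F} (hv : HasGradientWithinAt f v Θ θ) (hv' : HasGradientWithinAt f v' Θ θ')
    (hθ : θ ∈ Θ) (hθ' : θ' ∈ Θ) : 0 ≤ ⟪v' - v, θ' - θ⟫ := by
  have h1 := hf.inner_gradientWithin_le hv hθ hθ'
  have h2 := hf.inner_gradientWithin_le hv' hθ' hθ
  rw [← neg_sub θ' θ, inner_neg_right] at h2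
  rw [inner_sub_left]
  linarith

/-- First-order characterization of the minimizers of a sum of two convex functions, the first of
which has a gradient. -/
lemma ConvexOn.isMinOn_add_iff {Θ : Set F} {f r : F → ℝ} (hf : ConvexOn ℝ Θ f)
    (hr : ConvexOn ℝ Θ r) {v θ : F} (hv : HasGradientWithinAt f v Θ θ) (hθ : θ ∈ Θ) :
    IsMinOn (fun θ => f θ + r θ) Θ θ ↔ ∀ θ' ∈ Θ, r θ - r θ' ≤ ⟪v, θ' - θ⟫ := by
  refine ⟨fun h θ' hθ' => ?_, fun h θ' hθ' => ?_⟩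
  · refine ge_of_tendsto (hv.tendsto_slope hf.1 hθ hθ') ?_
    filter_upwards [Ioo_mem_nhdsGT (zero_lt_one (α := ℝ))] with t ht
    have h1 := hr.map_add_smul_sub_le hθ hθ' ht.1.le ht.2.le
    have h2 : f θ + r θ ≤ f (θ + t • (θ' - θ)) + r (θ + t • (θ' - θ)) :=
      h (hf.1.add_smul_sub_mem hθ hθ' ⟨ht.1.le, ht.2.le⟩)
    rw [le_inv_mul_iff₀ ht.1]
    linarith
  · have h1 := hf.inner_gradientWithin_le hv hθ hθ'
    have h2 := h θ' hθ'
    change f θ + r θ ≤ f θ' + r θ'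
    linarith

end Calculus

/-! ### Symmetry of the derivative of a supergradient field. -/

section Concave

open Filter Topology Metric
open scoped NNReal

variable {E : Type*} [NormedAddCommGroup E] [InnerProductSpace ℝ E]

/-- A Lipschitz field of supergradients along a dense set is a gradient, so its derivatives are
symmetric. -/
lemma LipschitzWith.isSymmetric_of_supergradient {D : Set E} (hD : Dense D) {T : E → E} {C : ℝ≥0}
    (hT : LipschitzWith C T) {φ : E → ℝ}
    (hφ : ∀ V ∈ D, ∀ W ∈ D, φ W ≤ φ V + ⟪T V, W - V⟫) {N : E →L[ℝ] E} {x : E}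
    (hN : HasFDerivAt T N x) : N.toLinearMap.IsSymmetric := by
  have hM : ∀ V ∈ ball x 1, ‖T V‖ ≤ ‖T x‖ + C := fun V hV => by
    have h1 := hT.dist_le_mul V x
    have h2 : ‖T V‖ ≤ ‖T x‖ + ‖T V - T x‖ := norm_le_norm_add_norm_sub' _ _
    rw [dist_eq_norm] at h1
    have h3 : (C : ℝ) * dist V x ≤ C * 1 := by gcongr; exact (mem_ball.1 hV).le
    linarith
  have hlip : LipschitzOnWith (‖T x‖₊ + C) φ (ball x 1 ∩ D) := by
    refine LipschitzOnWith.of_dist_le_mul fun V hV W hW => ?_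
    have hin : ∀ V ∈ ball x 1, ∀ h, |⟪T V, h⟫| ≤ (‖T x‖ + C) * ‖h‖ := fun V hV h =>
      (abs_real_inner_le_norm _ _).trans (by gcongr; exact hM V hV)
    have h1 := (hφ V hV.2 W hW.2).trans (add_le_add_right (le_of_abs_le (hin V hV.1 _)) _)
    have h2 := (hφ W hW.2 V hV.2).trans (add_le_add_right (le_of_abs_le (hin W hW.1 _)) _)
    rw [norm_sub_rev] at h1
    rw [Real.dist_eq, dist_eq_norm, abs_le]
    push_cast [coe_nnnorm]
    constructor <;> linarith
  -- The extension turns `φ` into a continuous function, so the supergradient inequality passes by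
  -- density to the whole ball.
  obtain ⟨ψ, hψ, hψφ⟩ := hlip.extend_real
  have hψT : ∀ V ∈ ball x 1, ∀ W ∈ ball x 1, ψ W ≤ ψ V + ⟪T V, W - V⟫ := by
    have hcl : IsClosed {p : E × E | ψ p.2 ≤ ψ p.1 + ⟪T p.1, p.2 - p.1⟫} := by
      have h1 := hψ.continuous
      have h2 := hT.continuous
      exact isClosed_le (by fun_prop) (by fun_prop)
    have hsub : (ball x 1 ∩ D) ×ˢ (ball x 1 ∩ D)
        ⊆ {p : E × E | ψ p.2 ≤ ψ p.1 + ⟪T p.1, p.2 - p.1⟫} := by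
      rintro ⟨V, W⟩ ⟨hV, hW⟩
      simp only [Set.mem_ofPred_eq, ← hψφ hV, ← hψφ hW]
      exact hφ V hV.2 W hW.2
    have hcl' := closure_minimal hsub hcl
    rw [closure_prod_eq] at hcl'
    have hB := hD.open_subset_closure_inter (isOpen_ball (x := x) (ε := 1))
    exact fun V hV W hW => @hcl' (V, W) ⟨hB hV, hB hW⟩
  have hder : ∀ᶠ V in 𝓝 x, HasFDerivAt ψ (innerSL ℝ (T V)) V := by
    filter_upwards [ball_mem_nhds x zero_lt_one] with V hV
    rw [hasFDerivAt_iff_isLittleO]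
    -- The supergradient inequalities at `V` and at `W` pinch the first-order remainder between `-C
    -- ‖W - V‖ ^ 2` and `0`.
    refine Asymptotics.IsBigO.trans_isLittleO (g := fun W => ‖W - V‖ ^ 2) ?_ ?_
    · refine Asymptotics.IsBigO.of_bound C ?_
      filter_upwards [isOpen_ball.mem_nhds hV] with W hW
      have h1 := hψT V hV W hW
      have h2 := hψT W hW V hV
      have h3 : |⟪T W - T V, W - V⟫| ≤ C * ‖W - V‖ ^ 2 := by
        refine (abs_real_inner_le_norm _ _).trans ?_
        have := hT.dist_le_mul W V
        rw [dist_eq_norm, dist_eq_norm] at this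
        nlinarith [norm_nonneg (W - V)]
      rw [← neg_sub W V, inner_neg_right] at h2
      rw [inner_sub_left, abs_le] at h3
      rw [innerSL_apply_apply, norm_pow, norm_norm, Real.norm_eq_abs, abs_le]
      constructor <;> nlinarith [sq_nonneg ‖W - V‖, C.coe_nonneg]
    · have := (Asymptotics.isLittleO_pow_id (𝕜 := ℝ) one_lt_two).comp_tendsto
        (tendsto_norm_sub_self V)
      exact this.norm_right.congr_right (fun _ => by simp) |>.of_norm_right
  let J : E →L[ℝ] E →L[ℝ] ℝ := innerSL ℝ
  have hx : HasFDerivAt (fun V => J (T V)) (J.comp N) x := J.hasFDerivAt.comp x hN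
  intro v w
  have := second_derivative_symmetric_of_eventually hder hx v w
  change ⟪N v, w⟫ = ⟪N w, v⟫ at this
  change ⟪N v, w⟫ = ⟪v, N w⟫
  rw [this, real_inner_comm]

end Concave

/-! ### Existence of minimizers. -/

section Existence

open Filter Topology Metric

variable {E : Type*} [NormedAddCommGroup E] [InnerProductSpace ℝ E] [FiniteDimensional ℝ E]

/-- Adding a quadratic term to a convex lower semicontinuous function on a nonempty closed set gives
a function that attains its minimum. -/
lemma ConvexOn.exists_isMinOn_add_sq {Θ : Set E} (hΘ : IsClosed Θ) {f : E → ℝ}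
    (hf : ConvexOn ℝ Θ f) (hl : LowerSemicontinuousOn f Θ) {θ₀ : E} (hθ₀ : θ₀ ∈ Θ) {k : ℝ}
    (hk : 0 < k) : ∃ θ ∈ Θ, IsMinOn (fun θ => f θ + k * ‖θ - θ₀‖ ^ 2) Θ θ := by
  have hcpt : ∀ R, IsCompact (Θ ∩ closedBall θ₀ R) := fun R =>
    (isCompact_closedBall θ₀ R).inter_left hΘ
  obtain ⟨p, -, hp⟩ := LowerSemicontinuousOn.exists_isMinOn
    (s := Θ ∩ closedBall θ₀ 1) ⟨θ₀, hθ₀, mem_closedBall_self zero_le_one⟩ (hcpt 1)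
    (hl.mono Set.inter_subset_left)
  have hc : f p ≤ f θ₀ := hp ⟨hθ₀, mem_closedBall_self zero_le_one⟩
  -- By convexity along rays from `θ₀`, `f` drops by at most `(f θ₀ - f p) ρ` at distance `ρ ≥ 1`.
  -- Beyond `R` the quadratic term outweighs this.
  set R := max 1 ((f θ₀ - f p) / k) with hR
  have hR1 : 1 ≤ R := le_max_left _ _
  have hlsc : LowerSemicontinuousOn (fun θ => f θ + k * ‖θ - θ₀‖ ^ 2) (Θ ∩ closedBall θ₀ R) :=
    (hl.mono Set.inter_subset_left).add (Continuous.lowerSemicontinuous (by fun_prop)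
      |>.lowerSemicontinuousOn _)
  obtain ⟨θ, hθ, hmin⟩ := LowerSemicontinuousOn.exists_isMinOn
    (s := Θ ∩ closedBall θ₀ R) ⟨θ₀, hθ₀, mem_closedBall_self (by linarith)⟩ (hcpt R) hlsc
  refine ⟨θ, hθ.1, fun θ' hθ' => ?_⟩
  by_cases hb : θ' ∈ closedBall θ₀ R
  · exact hmin ⟨hθ', hb⟩
  have h0 : f θ + k * ‖θ - θ₀‖ ^ 2 ≤ f θ₀ + k * ‖θ₀ - θ₀‖ ^ 2 :=
    hmin ⟨hθ₀, mem_closedBall_self (by linarith)⟩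
  rw [mem_closedBall, dist_eq_norm, not_le] at hb
  set ρ := ‖θ' - θ₀‖
  have hρ : 0 < ρ := by linarith
  have h1 := hf.map_add_smul_sub_le hθ₀ hθ' (t := ρ⁻¹) (by positivity)
    (inv_le_one_of_one_le₀ (by linarith))
  have h2 : f p ≤ f (θ₀ + ρ⁻¹ • (θ' - θ₀)) := by
    refine hp ⟨hf.1.add_smul_sub_mem hθ₀ hθ' ⟨by positivity, inv_le_one_of_one_le₀ (by linarith)⟩,
      ?_⟩
    rw [mem_closedBall, dist_eq_norm, add_sub_cancel_left, norm_smul, norm_inv, norm_norm,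
      inv_mul_cancel₀ hρ.ne']
  have h3 : f θ₀ - f p ≤ k * ρ := by
    have : (f θ₀ - f p) / k ≤ ρ := (le_max_right _ _).trans hb.le
    rwa [div_le_iff₀ hk, mul_comm] at this
  have h4 : ρ * (f p - f θ₀) ≤ f θ' - f θ₀ := by
    have : f p - f θ₀ ≤ ρ⁻¹ * (f θ' - f θ₀) := by linarith
    rwa [← div_eq_inv_mul, le_div_iff₀ hρ, mul_comm] at this
  change f θ + k * ‖θ - θ₀‖ ^ 2 ≤ f θ' + k * ρ ^ 2
  simp only [sub_self, norm_zero] at h0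
  nlinarith

end Existence

/-! ### The noise law and its change of variables. -/

section Noise

open Filter Topology Module

variable {m : ℕ}

lemma Seminorm.continuous_of_finiteDimensional (K : Seminorm ℝ (EuclideanSpace ℝ (Fin m))) :
    Continuous K := by
  rw [← continuousOn_univ]
  exact K.convexOn.continuousOn isOpen_univ

/-- The volume of the open unit ball of `a K` is this integral divided by a Gamma value. Without
integrability the integral would be `0` by convention, yet the ball has positive volume. -/
lemma Seminorm.integrable_exp_neg_mul (K : Seminorm ℝ (EuclideanSpace ℝ (Fin m)))
    (hK : ∀ v, K v = 0 → v = 0) {a : ℝ} (ha : 0 < a) :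
    Integrable fun v => Real.exp (-(a * K v)) := by
  have h := measure_lt_one_eq_integral_div_gamma (volume : Measure (EuclideanSpace ℝ (Fin m)))
    (g := fun v => a * K v) (by simp) (fun v => by simp [map_neg_eq_map])
    (fun v w => by
      rw [← mul_add]; exact mul_le_mul_of_nonneg_left (map_add_le_add K v w) ha.le)
    (fun {v} hv => hK v ((mul_eq_zero.1 hv).resolve_left ha.ne'))
    (fun s v => by rw [map_smul_eq_mul, Real.norm_eq_abs]; exact (mul_left_comm _ _ _).le)
    zero_lt_one
  simp only [Real.rpow_one] at h
  by_contra hni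
  rw [integral_undef hni, zero_div, ENNReal.ofReal_zero] at h
  have hopen : IsOpen {v : EuclideanSpace ℝ (Fin m) | a * K v < 1} :=
    isOpen_lt (continuous_const.mul K.continuous_of_finiteDimensional) continuous_const
  exact (hopen.measure_pos volume ⟨0, by simp⟩).ne' h

lemma kNormUnnormalized_univ_ne_top (K : Seminorm ℝ (EuclideanSpace ℝ (Fin m)))
    (hK : ∀ v, K v = 0 → v = 0) {a : ℝ} (ha : 0 < a) : kNormUnnormalized K a Set.univ ≠ ⊤ := by
  rw [kNormUnnormalized, withDensity_apply _ MeasurableSet.univ, Measure.restrict_univ]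
  exact (K.integrable_exp_neg_mul hK ha).lintegral_lt_top.ne

lemma volume_absolutelyContinuous_kNormUnnormalized (K : Seminorm ℝ (EuclideanSpace ℝ (Fin m)))
    (a : ℝ) : volume ≪ kNormUnnormalized K a := by
  have hc := K.continuous_of_finiteDimensional
  refine withDensity_absolutelyContinuous' ?_ (.of_forall fun v => ?_)
  · exact (ENNReal.continuous_ofReal.comp (by fun_prop)).measurable.aemeasurable
  · exact (ENNReal.ofReal_pos.2 (Real.exp_pos _)).ne'

lemma kNormNoise_absolutelyContinuous_volume (K : Seminorm ℝ (EuclideanSpace ℝ (Fin m)))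
    (a : ℝ) : kNormNoise K a ≪ volume :=
  (withDensity_absolutelyContinuous _ _).smul_left _

lemma volume_absolutelyContinuous_kNormNoise (K : Seminorm ℝ (EuclideanSpace ℝ (Fin m)))
    (hK : ∀ v, K v = 0 → v = 0) {a : ℝ} (ha : 0 < a) : volume ≪ kNormNoise K a :=
  (volume_absolutelyContinuous_kNormUnnormalized K a).trans
    (Measure.absolutelyContinuous_smul
      (ENNReal.inv_ne_zero.2 (kNormUnnormalized_univ_ne_top K hK ha)))

lemma isProbabilityMeasure_kNormNoise (K : Seminorm ℝ (EuclideanSpace ℝ (Fin m)))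
    (hK : ∀ v, K v = 0 → v = 0) {a : ℝ} (ha : 0 < a) :
    IsProbabilityMeasure (kNormNoise K a) := by
  constructor
  rw [kNormNoise, Measure.smul_apply, smul_eq_mul]
  refine ENNReal.inv_mul_cancel (fun h => ?_) (kNormUnnormalized_univ_ne_top K hK ha)
  exact NeZero.ne _ (volume_absolutelyContinuous_kNormUnnormalized K a h)

/-- Change of variables for the `K`-norm density: a map that moves no point by more than `Δ` and has
Jacobian at least `c` shrinks the mass of a set by at most the factor `c * exp (-(a * Δ))`. -/
lemma kNormUnnormalized_le_image {K : Seminorm ℝ (EuclideanSpace ℝ (Fin m))} {a Δ c : ℝ}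
    (ha : 0 ≤ a) {A : Set (EuclideanSpace ℝ (Fin m))} (hA : MeasurableSet A)
    {Ψ : EuclideanSpace ℝ (Fin m) → EuclideanSpace ℝ (Fin m)}
    {Ψ' : EuclideanSpace ℝ (Fin m) → EuclideanSpace ℝ (Fin m) →L[ℝ] EuclideanSpace ℝ (Fin m)}
    (hΨ : Set.InjOn Ψ A) (hΨ' : ∀ v ∈ A, HasFDerivWithinAt Ψ (Ψ' v) A v)
    (hdet : ∀ v ∈ A, c ≤ |(Ψ' v).det|) (hmove : ∀ v ∈ A, K (Ψ v - v) ≤ Δ) :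
    ENNReal.ofReal (c * Real.exp (-(a * Δ))) * kNormUnnormalized K a A
      ≤ kNormUnnormalized K a (Ψ '' A) := by
  -- This direction needs no measurability of the image.
  refine le_trans ?_ (withDensity_apply_le _ _)
  rw [lintegral_image_eq_lintegral_abs_det_fderiv_mul volume hA hΨ' hΨ, kNormUnnormalized,
    withDensity_apply _ hA, ← lintegral_const_mul' _ _ ENNReal.ofReal_ne_top]
  refine setLIntegral_mono' hA fun v hv => ?_
  rw [← ENNReal.ofReal_mul' (Real.exp_pos _).le, ← ENNReal.ofReal_mul (abs_nonneg _), mul_assoc,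
    ← Real.exp_add]
  refine ENNReal.ofReal_le_ofReal ?_
  refine mul_le_mul (hdet v hv) (Real.exp_le_exp.2 ?_) (Real.exp_pos _).le (abs_nonneg _)
  have h1 : K (Ψ v) ≤ K (Ψ v - v) + K v := by
    simpa using map_add_le_add K (Ψ v - v) v
  nlinarith [hmove v hv]

end Noise

/-! ### Optimality, stability and existence for the perturbed objective. -/

section ObjectivePerturbation

open Filter Topology Module
open scoped NNReal

variable {𝒳 : Type*} {m n : ℕ}

/-- The gradient of `n` times the perturbed objective without its regularizer `r`. -/
def perturbedGradient (g : 𝒳 → EuclideanSpace ℝ (Fin m) → EuclideanSpace ℝ (Fin m)) (γ : ℝ)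
    (X : Fin n → 𝒳) (V θ : EuclideanSpace ℝ (Fin m)) : EuclideanSpace ℝ (Fin m) :=
  ∑ i, g (X i) θ + γ • θ + V

variable {Θ : Set (EuclideanSpace ℝ (Fin m))} {r : EuclideanSpace ℝ (Fin m) → ℝ}
  {ℓ : EuclideanSpace ℝ (Fin m) → 𝒳 → ℝ}
  {g : 𝒳 → EuclideanSpace ℝ (Fin m) → EuclideanSpace ℝ (Fin m)} {γ : ℝ}

lemma natCast_mul_perturbedObjective (hn : 0 < n) (X : Fin n → 𝒳)
    (V θ : EuclideanSpace ℝ (Fin m)) :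
    n * perturbedObjective ℓ r γ X V θ
      = n * empiricalLoss ℓ X θ + γ / 2 * ⟪θ, θ⟫ + ⟪V, θ⟫ + r θ := by
  have : (n : ℝ) ≠ 0 := by positivity
  rw [perturbedObjective]
  field_simp
  ring

/-- A constant database isolates a single loss. -/
lemma convexOn_loss (hn : 0 < n) (hconv : ∀ X : Fin n → 𝒳, ConvexOn ℝ Θ (empiricalLoss ℓ X))
    (x : 𝒳) : ConvexOn ℝ Θ fun θ => ℓ θ x := by
  convert hconv fun _ => x using 2 with θ
  have : (n : ℝ) ≠ 0 := by positivity
  simp [empiricalLoss, this]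

lemma hasFDerivWithinAt_natCast_mul_empiricalLoss (hn : 0 < n)
    (hg : ∀ x, ∀ θ ∈ Θ, HasGradientWithinAt (fun θ => ℓ θ x) (g x θ) Θ θ) (X : Fin n → 𝒳)
    {θ : EuclideanSpace ℝ (Fin m)} (hθ : θ ∈ Θ) :
    HasFDerivWithinAt (fun θ => n * empiricalLoss ℓ X θ)
      (∑ i, InnerProductSpace.toDual ℝ _ (g (X i) θ)) Θ θ := by
  have : (n : ℝ) ≠ 0 := by positivity
  have key : ∀ θ, n * empiricalLoss ℓ X θ = ∑ i, ℓ θ (X i) := fun θ => by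
    rw [empiricalLoss, ← mul_assoc, mul_one_div_cancel this, one_mul]
  simp only [key]
  exact HasFDerivWithinAt.fun_sum fun i _ => (hg (X i) θ hθ).hasFDerivWithinAt

/-- First-order optimality condition for the perturbed objective. -/
lemma isArgMin_perturbedObjective_iff (hn : 0 < n) (hγ : 0 ≤ γ) (hr : ConvexOn ℝ Θ r)
    (hconv : ∀ X : Fin n → 𝒳, ConvexOn ℝ Θ (empiricalLoss ℓ X))
    (hg : ∀ x, ∀ θ ∈ Θ, HasGradientWithinAt (fun θ => ℓ θ x) (g x θ) Θ θ) (X : Fin n → 𝒳)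
    (V θ : EuclideanSpace ℝ (Fin m)) :
    IsArgMin (perturbedObjective ℓ r γ X V) Θ θ ↔
      θ ∈ Θ ∧ ∀ θ' ∈ Θ, r θ - r θ' ≤ ⟪perturbedGradient g γ X V θ, θ' - θ⟫ := by
  have hn' : (0 : ℝ) < n := by positivity
  rw [IsArgMin]
  refine and_congr_right fun hθ => ?_
  have hf : ConvexOn ℝ Θ fun θ => n * empiricalLoss ℓ X θ + γ / 2 * ⟪θ, θ⟫ + ⟪V, θ⟫ := by
    refine (((hconv X).smul hn'.le).add (ConvexOn.smul (by positivity) ?_)).add ?_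
    · have := (convexOn_norm hr.1).pow (fun _ _ => norm_nonneg _) 2
      exact this.congr fun θ _ => (real_inner_self_eq_norm_sq θ).symm
    · exact (innerSL ℝ V).toLinearMap.convexOn hr.1
  have hv : HasGradientWithinAt (fun θ => n * empiricalLoss ℓ X θ + γ / 2 * ⟪θ, θ⟫ + ⟪V, θ⟫)
      (perturbedGradient g γ X V θ) Θ θ := by
    rw [hasGradientWithinAt_iff_hasFDerivWithinAt]
    have hid := hasFDerivWithinAt_id (𝕜 := ℝ) θ Θ
    refine (((hasFDerivWithinAt_natCast_mul_empiricalLoss hn hg X hθ).add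
      ((hid.inner ℝ hid).const_mul (γ / 2))).add (innerSL ℝ V).hasFDerivWithinAt).congr_fderiv ?_
    ext h
    simp [perturbedGradient, fderivInnerCLM_apply, real_inner_comm]
    ring
  rw [← hf.isMinOn_add_iff hr hv hθ]
  simp only [isMinOn_iff, ← natCast_mul_perturbedObjective hn]
  exact forall₂_congr fun θ' _ => (mul_le_mul_iff_right₀ hn').symm

/-- The minimizers of the perturbed objective form a strongly monotone family. -/
lemma IsArgMin.add_mul_sq_norm_sub_le (hn : 0 < n) (hγ : 0 ≤ γ) (hr : ConvexOn ℝ Θ r)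
    (hconv : ∀ X : Fin n → 𝒳, ConvexOn ℝ Θ (empiricalLoss ℓ X))
    (hg : ∀ x, ∀ θ ∈ Θ, HasGradientWithinAt (fun θ => ℓ θ x) (g x θ) Θ θ) {X : Fin n → 𝒳}
    {V W θ θ' : EuclideanSpace ℝ (Fin m)} (h : IsArgMin (perturbedObjective ℓ r γ X V) Θ θ)
    (h' : IsArgMin (perturbedObjective ℓ r γ X W) Θ θ') (i : Fin n) :
    ⟪g (X i) θ' - g (X i) θ, θ' - θ⟫ + γ * ‖θ' - θ‖ ^ 2 ≤ -⟪W - V, θ' - θ⟫ := by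
  rw [isArgMin_perturbedObjective_iff hn hγ hr hconv hg] at h h'
  have h1 := h.2 θ' h'.1
  have h2 := h'.2 θ h.1
  rw [← neg_sub θ' θ, inner_neg_right] at h2
  -- Each gradient is monotone, so every term but the `i`-th can be dropped.
  have h3 : ⟪g (X i) θ' - g (X i) θ, θ' - θ⟫ ≤ ∑ j, ⟪g (X j) θ' - g (X j) θ, θ' - θ⟫ :=
    Finset.single_le_sum (f := fun j => ⟪g (X j) θ' - g (X j) θ, θ' - θ⟫)
      (fun j _ => (convexOn_loss hn hconv (X j)).inner_gradientWithin_sub_nonneg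
        (hg _ _ h.1) (hg _ _ h'.1) h.1 h'.1) (Finset.mem_univ i)
  rw [← sum_inner, Finset.sum_sub_distrib] at h3
  have h4 : γ * ‖θ' - θ‖ ^ 2 = ⟪γ • θ', θ' - θ⟫ - ⟪γ • θ, θ' - θ⟫ := by
    rw [← real_inner_self_eq_norm_sq, ← inner_sub_left, ← smul_sub, real_inner_smul_left]
  simp only [perturbedGradient, inner_add_left, inner_sub_left] at h1 h2 h3 ⊢
  linarith

lemma IsArgMin.norm_sub_le (hn : 0 < n) (hγ : 0 < γ) (hr : ConvexOn ℝ Θ r)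
    (hconv : ∀ X : Fin n → 𝒳, ConvexOn ℝ Θ (empiricalLoss ℓ X))
    (hg : ∀ x, ∀ θ ∈ Θ, HasGradientWithinAt (fun θ => ℓ θ x) (g x θ) Θ θ) {X : Fin n → 𝒳}
    {V W θ θ' : EuclideanSpace ℝ (Fin m)} (h : IsArgMin (perturbedObjective ℓ r γ X V) Θ θ)
    (h' : IsArgMin (perturbedObjective ℓ r γ X W) Θ θ') : ‖θ' - θ‖ ≤ γ⁻¹ * ‖W - V‖ := by
  have h1 := h.add_mul_sq_norm_sub_le hn hγ.le hr hconv hg h' ⟨0, hn⟩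
  have h2 := (convexOn_loss hn hconv (X ⟨0, hn⟩)).inner_gradientWithin_sub_nonneg
    (hg _ _ h.1) (hg _ _ h'.1) h.1 h'.1
  have h3 := neg_le_of_abs_le (abs_real_inner_le_norm (W - V) (θ' - θ))
  rw [le_inv_mul_iff₀ hγ]
  rcases (norm_nonneg (θ' - θ)).eq_or_lt with h0 | h0
  · rw [← h0]; simp
  · refine le_of_mul_le_mul_right ?_ h0
    linarith

lemma IsArgMin.eq (hn : 0 < n) (hγ : 0 < γ) (hr : ConvexOn ℝ Θ r)
    (hconv : ∀ X : Fin n → 𝒳, ConvexOn ℝ Θ (empiricalLoss ℓ X))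
    (hg : ∀ x, ∀ θ ∈ Θ, HasGradientWithinAt (fun θ => ℓ θ x) (g x θ) Θ θ) {X : Fin n → 𝒳}
    {V θ θ' : EuclideanSpace ℝ (Fin m)} (h : IsArgMin (perturbedObjective ℓ r γ X V) Θ θ)
    (h' : IsArgMin (perturbedObjective ℓ r γ X V) Θ θ') : θ' = θ := by
  have := h.norm_sub_le hn hγ hr hconv hg h'
  rw [sub_self, norm_zero, mul_zero] at this
  exact sub_eq_zero.1 (norm_le_zero_iff.1 this)

/-- Shifting the noise by a difference of gradients compensates for a change of the database. -/
lemma IsArgMin.of_sum_add_eq (hn : 0 < n) (hγ : 0 ≤ γ) (hr : ConvexOn ℝ Θ r)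
    (hconv : ∀ X : Fin n → 𝒳, ConvexOn ℝ Θ (empiricalLoss ℓ X))
    (hg : ∀ x, ∀ θ ∈ Θ, HasGradientWithinAt (fun θ => ℓ θ x) (g x θ) Θ θ) {X X' : Fin n → 𝒳}
    {V W θ : EuclideanSpace ℝ (Fin m)} (h : IsArgMin (perturbedObjective ℓ r γ X V) Θ θ)
    (heq : ∑ i, g (X i) θ + V = ∑ i, g (X' i) θ + W) :
    IsArgMin (perturbedObjective ℓ r γ X' W) Θ θ := by
  rw [isArgMin_perturbedObjective_iff hn hγ hr hconv hg] at h ⊢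
  have : perturbedGradient g γ X V θ = perturbedGradient g γ X' W θ := by
    rw [perturbedGradient, perturbedGradient, add_right_comm, heq, add_right_comm]
  rwa [this] at h

/-- A minimizer exists when the domain is closed and the regularizer lower semicontinuous. -/
lemma exists_isArgMin_perturbedObjective (hn : 0 < n) (hγ : 0 < γ) (hr : ConvexOn ℝ Θ r)
    (hconv : ∀ X : Fin n → 𝒳, ConvexOn ℝ Θ (empiricalLoss ℓ X))
    (hg : ∀ x, ∀ θ ∈ Θ, HasGradientWithinAt (fun θ => ℓ θ x) (g x θ) Θ θ) (hcl : IsClosed Θ)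
    (hne : Θ.Nonempty) (hl : LowerSemicontinuousOn r Θ) (X : Fin n → 𝒳)
    (V : EuclideanSpace ℝ (Fin m)) : ∃ θ, IsArgMin (perturbedObjective ℓ r γ X V) Θ θ := by
  have hn' : (0 : ℝ) < n := by positivity
  obtain ⟨θ₀, hθ₀⟩ := hne
  -- Recentring the quadratic at `θ₀ ∈ Θ` leaves the linear term `γ ⟪θ₀, θ⟫` and a constant.
  have hlin : ConvexOn ℝ Θ fun θ => ⟪V + γ • θ₀, θ⟫ :=
    (innerSL ℝ (V + γ • θ₀)).toLinearMap.convexOn hr.1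
  have hcont : ContinuousOn (fun θ => n * empiricalLoss ℓ X θ + ⟪V + γ • θ₀, θ⟫) Θ :=
    ContinuousOn.add (fun θ hθ =>
      (hasFDerivWithinAt_natCast_mul_empiricalLoss hn hg X hθ).continuousWithinAt) (by fun_prop)
  obtain ⟨θ, hθ, hmin⟩ := ((((hconv X).smul hn'.le).add hlin).add hr).exists_isMinOn_add_sq hcl
    (hcont.lowerSemicontinuousOn.add hl) hθ₀ (k := γ / 2) (by positivity)
  refine ⟨θ, hθ, fun θ' hθ' => ?_⟩
  have key : ∀ θ, n * perturbedObjective ℓ r γ X V θ = n * empiricalLoss ℓ X θ + ⟪V + γ • θ₀, θ⟫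
      + r θ + γ / 2 * ‖θ - θ₀‖ ^ 2 - γ / 2 * ‖θ₀‖ ^ 2 := fun θ => by
    rw [natCast_mul_perturbedObjective hn, norm_sub_sq_real, inner_add_left, real_inner_smul_left,
      real_inner_self_eq_norm_sq, real_inner_comm θ₀ θ]
    ring
  have h : n * empiricalLoss ℓ X θ + ⟪V + γ • θ₀, θ⟫ + r θ + γ / 2 * ‖θ - θ₀‖ ^ 2
      ≤ n * empiricalLoss ℓ X θ' + ⟪V + γ • θ₀, θ'⟫ + r θ' + γ / 2 * ‖θ' - θ₀‖ ^ 2 := hmin hθ'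
  refine (mul_le_mul_iff_right₀ hn').1 ?_
  rw [key, key]
  linarith

end ObjectivePerturbation

/-! ### Differentiability of the minimizer and the Jacobian of the noise shift. -/

section ObjectivePerturbation

open Filter Topology Module
open scoped NNReal

variable {𝒳 : Type*} {m n : ℕ} {Θ : Set (EuclideanSpace ℝ (Fin m))}
  {r : EuclideanSpace ℝ (Fin m) → ℝ} {ℓ : EuclideanSpace ℝ (Fin m) → 𝒳 → ℝ}
  {g : 𝒳 → EuclideanSpace ℝ (Fin m) → EuclideanSpace ℝ (Fin m)}
  {H : 𝒳 → EuclideanSpace ℝ (Fin m) → EuclideanSpace ℝ (Fin m) →L[ℝ] EuclideanSpace ℝ (Fin m)}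
  {γ lam : ℝ}

/-- An almost everywhere defined minimizer agrees, on a set of full measure, with a Lipschitz map
that is differentiable with a symmetric derivative on this set. -/
lemma exists_lipschitzWith_isArgMin (hn : 0 < n) (hγ : 0 < γ) (hr : ConvexOn ℝ Θ r)
    (hconv : ∀ X : Fin n → 𝒳, ConvexOn ℝ Θ (empiricalLoss ℓ X))
    (hg : ∀ x, ∀ θ ∈ Θ, HasGradientWithinAt (fun θ => ℓ θ x) (g x θ) Θ θ) {X : Fin n → 𝒳}
    {S : EuclideanSpace ℝ (Fin m) → EuclideanSpace ℝ (Fin m)}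
    (hS : ∀ᵐ V, IsArgMin (perturbedObjective ℓ r γ X V) Θ (S V)) :
    ∃ (T : EuclideanSpace ℝ (Fin m) → EuclideanSpace ℝ (Fin m))
      (N : EuclideanSpace ℝ (Fin m) → EuclideanSpace ℝ (Fin m) →L[ℝ] EuclideanSpace ℝ (Fin m))
      (D : Set (EuclideanSpace ℝ (Fin m))),
      Continuous T ∧ MeasurableSet D ∧ D ∈ ae volume ∧
      ∀ V ∈ D, S V = T V ∧ IsArgMin (perturbedObjective ℓ r γ X V) Θ (T V) ∧
        HasFDerivAt T (N V) V ∧ (N V).toLinearMap.IsSymmetric := by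
  set D₀ := {V | IsArgMin (perturbedObjective ℓ r γ X V) Θ (S V)}
  have hlip : LipschitzOnWith γ⁻¹.toNNReal S D₀ := by
    refine LipschitzOnWith.of_dist_le_mul fun V hV W hW => ?_
    rw [dist_eq_norm, dist_eq_norm, Real.coe_toNNReal _ (inv_pos.2 hγ).le]
    exact IsArgMin.norm_sub_le hn hγ hr hconv hg hW hV
  obtain ⟨T, hT, hST⟩ := hlip.extend_finite_dimension
  have hae : ∀ᵐ V, V ∈ D₀ ∧ DifferentiableAt ℝ T V := hS.and hT.ae_differentiableAt
  -- `D₀` is not known to be measurable, so a measurable null superset of the bad points is removed.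
  obtain ⟨D, hDsub, hDm, hDae⟩ := exists_measurable_superset_of_null (ae_iff.1 hae)
  refine ⟨T, fun V => fderiv ℝ T V, Dᶜ, hT.continuous, hDm.compl,
    mem_ae_iff.2 (by rwa [compl_compl]), fun V hV => ?_⟩
  have hV' : V ∈ D₀ ∧ DifferentiableAt ℝ T V := by
    by_contra h
    exact hV (hDsub h)
  refine ⟨hST hV'.1, hST hV'.1 ▸ hV'.1, hV'.2.hasFDerivAt, ?_⟩
  -- `n` times the optimal value is an infimum of functions affine in `V`; the minimizer is the
  -- slope of the active one.
  refine hT.isSymmetric_of_supergradient (D := D₀) (Measure.dense_of_ae hS)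
    (φ := fun V => n * perturbedObjective ℓ r γ X V (S V)) (fun V hV W hW => ?_) hV'.2.hasFDerivAt
  have h0 : perturbedObjective ℓ r γ X W (S W) ≤ perturbedObjective ℓ r γ X W (S V) := hW.2 hV.1
  have h1 := mul_le_mul_of_nonneg_left h0 (n.cast_nonneg (α := ℝ))
  simp only [natCast_mul_perturbedObjective hn] at h1 ⊢
  rw [← hST hV, inner_sub_right, real_inner_comm W (S V), real_inner_comm V (S V)]
  linarith

/-- The Jacobian of the noise shift is bounded below. -/
lemma hasFDerivWithinAt_noise_shift (hn : 0 < n) (hγ : 0 < γ) (hlam : 0 < lam)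
    (hr : ConvexOn ℝ Θ r) (hconv : ∀ X : Fin n → 𝒳, ConvexOn ℝ Θ (empiricalLoss ℓ X))
    (hgH : ∀ x, HasGradientHessianOn (fun θ => ℓ θ x) (g x) (H x) Θ)
    (hrank : ∀ x, ∀ θ ∈ Θ, finrank ℝ (LinearMap.range (H x θ).toLinearMap) ≤ 1)
    (heig : ∀ x, ∀ θ ∈ Θ, ∀ μ : ℝ, End.HasEigenvalue (H x θ).toLinearMap μ → μ ≤ lam)
    {X : Fin n → 𝒳} {T : EuclideanSpace ℝ (Fin m) → EuclideanSpace ℝ (Fin m)}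
    {D : Set (EuclideanSpace ℝ (Fin m))} (hD : Dense D)
    (hT : ∀ V ∈ D, IsArgMin (perturbedObjective ℓ r γ X V) Θ (T V))
    {V : EuclideanSpace ℝ (Fin m)} (hV : V ∈ D)
    {N : EuclideanSpace ℝ (Fin m) →L[ℝ] EuclideanSpace ℝ (Fin m)} (hN : HasFDerivAt T N V)
    (hNs : N.toLinearMap.IsSymmetric) (i : Fin n) (x : 𝒳) :
    HasFDerivWithinAt (fun V => V + g (X i) (T V) - g x (T V))
      (.id ℝ _ + (H (X i) (T V)).comp N - (H x (T V)).comp N) D V ∧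
    γ / (lam + γ) ≤
      (.id ℝ _ + (H (X i) (T V)).comp N - (H x (T V)).comp N : _ →L[ℝ] _).det := by
  have hg := fun x => (hgH x).hasGradient
  have hmaps : Set.MapsTo T D Θ := fun V hV => (hT V hV).1
  have hTV := hmaps hV
  have hcomp : ∀ z, HasFDerivWithinAt (fun V => g z (T V)) ((H z (T V)).comp N) D V := fun z =>
    ((hgH z).hasHessian _ hTV).comp V hN.hasFDerivWithinAt hmaps
  refine ⟨((hasFDerivWithinAt_id V D).add (hcomp _)).sub (hcomp x), ?_⟩
  -- Only directions `N h` are controlled: `Θ` may have empty interior, so the Hessian need not be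
  -- positive semidefinite elsewhere.
  have hmono : ∀ z h, 0 ≤ ⟪H z (T V) (N h), N h⟫ := fun z =>
    hD.inner_hasFDerivWithinAt_nonneg (hcomp z) hN.hasFDerivWithinAt fun W hW =>
      (convexOn_loss hn hconv z).inner_gradientWithin_sub_nonneg (hg _ _ hTV)
        (hg _ _ (hmaps hW)) hTV (hmaps hW)
  have hstrong : ∀ h, ⟪H (X i) (T V) (N h), N h⟫ + γ * ‖N h‖ ^ 2 ≤ -⟪h, N h⟫ := fun h => by
    -- Strong monotonicity says that `-V - g (X i) (T V) - γ • T V` is monotone against `T V`.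
    have := hD.inner_hasFDerivWithinAt_nonneg
      (((hasFDerivWithinAt_id V D).neg.sub (hcomp (X i))).sub
        (hN.hasFDerivWithinAt.const_smul γ)) hN.hasFDerivWithinAt (fun W hW => by
      have := (hT V hV).add_mul_sq_norm_sub_le hn hγ.le hr hconv hg (hT W hW) i
      rw [← real_inner_self_eq_norm_sq] at this
      simp only [Pi.sub_apply, Pi.neg_apply, Pi.smul_apply, id, inner_sub_left, inner_neg_left,
        real_inner_smul_left] at this ⊢
      linarith) h
    simp only [sub_apply, neg_apply, smul_apply, ContinuousLinearMap.comp_apply,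
      ContinuousLinearMap.id_apply, inner_sub_left, inner_neg_left, real_inner_smul_left, real_inner_self_eq_norm_sq] at this
    linarith
  obtain ⟨μ, u, hu, hHu, hμ⟩ := LinearMap.IsSymmetric.exists_eq_smul_of_finrank_range_le_one
    ((hgH (X i)).symmetric _ hTV) (hrank _ _ hTV)
  obtain ⟨ν, v, -, hHv, -⟩ := LinearMap.IsSymmetric.exists_eq_smul_of_finrank_range_le_one
    ((hgH x).symmetric _ hTV) (hrank _ _ hTV)
  simp only [ContinuousLinearMap.coe_coe] at hHu hHv
  have hquad : ∀ (c : ℝ) (w h : EuclideanSpace ℝ (Fin m)),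
      ⟪(c * ⟪w, h⟫) • w, h⟫ = c * ⟪w, h⟫ ^ 2 := fun c w h => by
    rw [real_inner_smul_left]; ring
  refine le_det_of_rank_one_sub_rank_one hNs hγ hlam
    (hμ.elim (fun h => h ▸ hlam.le) (heig _ _ hTV μ)) hu (ν := ν) (v := v)
    (fun h => ?_) (fun h => ?_) (fun h => ?_) (fun h => ?_)
  · simpa only [hHu, hquad, ContinuousLinearMap.coe_coe] using hmono (X i) h
  · simpa only [hHv, hquad, ContinuousLinearMap.coe_coe] using hmono x h
  · simpa only [hHu, hquad, ContinuousLinearMap.coe_coe] using hstrong h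
  · simp [hHu, hHv]

lemma exists_sum_eq_of_hammingDist_eq_one [DecidableEq 𝒳] {X X' : Fin n → 𝒳}
    (h : hammingDist X X' = 1) :
    ∃ i, ∀ f : 𝒳 → EuclideanSpace ℝ (Fin m), ∑ j, f (X j) + f (X' i) = ∑ j, f (X' j) + f (X i) := by
  obtain ⟨i, hi⟩ := Finset.card_eq_one.1 h
  have hne : ∀ j ∈ Finset.univ.erase i, X j = X' j := fun j hj => by
    by_contra hne
    have : j ∈ ({i} : Finset (Fin n)) := hi ▸ Finset.mem_filter.2 ⟨Finset.mem_univ j, hne⟩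
    exact (Finset.mem_erase.1 hj).1 (Finset.mem_singleton.1 this)
  refine ⟨i, fun f => ?_⟩
  rw [← Finset.add_sum_erase _ _ (Finset.mem_univ i),
    ← Finset.add_sum_erase _ (fun j => f (X' j)) (Finset.mem_univ i),
    Finset.sum_congr rfl fun j hj => congrArg f (hne j hj)]
  abel

end ObjectivePerturbation

/-! ### The privacy bound. -/

theorem mainTheorem9 {𝒳 : Type*} {m n : ℕ} (hn : 0 < n)
    (ε : ℝ) (hε : 0 < ε) (q : ℝ) (hq0 : 0 < q) (hq1 : q < 1)
    (Δ : ℝ) (hΔ : 0 < Δ) (lam : ℝ) (hlam : 0 < lam)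
    (Θ : Set (EuclideanSpace ℝ (Fin m))) (hΘ : Convex ℝ Θ)
    (r : EuclideanSpace ℝ (Fin m) → ℝ) (hr : ConvexOn ℝ Θ r)
    (ℓ : EuclideanSpace ℝ (Fin m) → 𝒳 → ℝ)
    (hconv : ∀ X : Fin n → 𝒳, ConvexOn ℝ Θ (empiricalLoss ℓ X))
    (g : 𝒳 → EuclideanSpace ℝ (Fin m) → EuclideanSpace ℝ (Fin m))
    (H : 𝒳 → EuclideanSpace ℝ (Fin m) →
      EuclideanSpace ℝ (Fin m) →L[ℝ] EuclideanSpace ℝ (Fin m))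
    (hgH : ∀ x, HasGradientHessianOn (fun θ => ℓ θ x) (g x) (H x) Θ)
    (hrank : ∀ x, ∀ θ ∈ Θ, Module.finrank ℝ (LinearMap.range (H x θ).toLinearMap) ≤ 1)
    (heig : ∀ x, ∀ θ ∈ Θ, ∀ μ : ℝ, Module.End.HasEigenvalue (H x θ).toLinearMap μ → μ ≤ lam)
    (K : Seminorm ℝ (EuclideanSpace ℝ (Fin m))) (hK : ∀ v, K v = 0 → v = 0)
    (hsens : ∀ x x', ∀ θ ∈ Θ, K (g x θ - g x' θ) ≤ Δ)
    (γ : ℝ) (hγ : γ = lam / (Real.exp (ε * (1 - q)) - 1)) :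
    -- the minimisation step has exactly one solution when `Θ` is closed and nonempty
    -- and `r` is lower semicontinuous
    (IsClosed Θ → Θ.Nonempty → LowerSemicontinuousOn r Θ →
      ∀ (X : Fin n → 𝒳) (V : EuclideanSpace ℝ (Fin m)),
        ∃! θ, IsArgMin (perturbedObjective ℓ r γ X V) Θ θ) ∧
    -- privacy, whenever the minimisation step almost surely has a solution
    (∀ θDP : (Fin n → 𝒳) → EuclideanSpace ℝ (Fin m) → EuclideanSpace ℝ (Fin m),
      (∀ X, ∀ᵐ V ∂(kNormNoise K (ε * q / Δ)),
        IsArgMin (perturbedObjective ℓ r γ X V) Θ (θDP X V)) →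
      (∀ X, AEMeasurable (θDP X) (kNormNoise K (ε * q / Δ))) ∧
      IsDifferentiallyPrivate ε (fun X => (kNormNoise K (ε * q / Δ)).map (θDP X))) := by
  classical
  have hexp : 1 < Real.exp (ε * (1 - q)) := Real.one_lt_exp_iff.2 (mul_pos hε (by linarith))
  have hγ0 : 0 < γ := hγ ▸ div_pos hlam (by linarith)
  have hg := fun x => (hgH x).hasGradient
  set a := ε * q / Δ with ha_def
  have ha : 0 < a := by positivity
  refine ⟨fun hcl hne hl X V => ?_, fun θDP hθDP => ?_⟩
  · obtain ⟨θ, hθ⟩ := exists_isArgMin_perturbedObjective hn hγ0 hr hconv hg hcl hne hl X V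
    exact ⟨θ, hθ, fun θ' hθ' => hθ.eq hn hγ0 hr hconv hg hθ'⟩
  have hac := volume_absolutelyContinuous_kNormNoise K hK ha
  have hac' := kNormNoise_absolutelyContinuous_volume K a
  choose T N D hTc hDm hD hTD using fun X =>
    exists_lipschitzWith_isArgMin hn hγ0 hr hconv hg (hac.ae_le (hθDP X))
  have hae : ∀ X, θDP X =ᵐ[kNormNoise K a] T X := fun X =>
    hac'.ae_le (Filter.mem_of_superset (hD X) fun V hV => (hTD X V hV).1)
  have hmeas : ∀ X, AEMeasurable (θDP X) (kNormNoise K a) := fun X =>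
    ⟨T X, (hTc X).measurable, hae X⟩
  have := isProbabilityMeasure_kNormNoise K hK ha
  refine ⟨hmeas, fun X => Measure.isProbabilityMeasure_map (hmeas X), fun X X' hXX' B hB => ?_⟩
  change (kNormNoise K a).map (θDP X') B ≤ ENNReal.ofReal (Real.exp ε) *
    (kNormNoise K a).map (θDP X) B
  rw [Measure.map_congr (hae X), Measure.map_congr (hae X'),
    Measure.map_apply (hTc X).measurable hB, Measure.map_apply (hTc X').measurable hB, kNormNoise,
    Measure.smul_apply, Measure.smul_apply, smul_eq_mul, smul_eq_mul, mul_left_comm]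
  gcongr
  have hcac : kNormUnnormalized K a ≪ volume := withDensity_absolutelyContinuous _ _
  rw [← measure_inter_conull (hcac.ae_le (hD X')),
    ← measure_inter_conull (s := T X ⁻¹' B) (hcac.ae_le (hD X))]
  obtain ⟨i, hi⟩ := exists_sum_eq_of_hammingDist_eq_one (m := m) (by convert hXX')
  set Ψ := fun V => V + g (X' i) (T X' V) - g (X i) (T X' V) with hΨ
  have hΨmin : ∀ V ∈ D X', IsArgMin (perturbedObjective ℓ r γ X (Ψ V)) Θ (T X' V) := fun V hV =>
    (hTD X' V hV).2.1.of_sum_add_eq hn hγ0.le hr hconv hg (by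
      rw [eq_sub_of_add_eq (hi fun z => g z (T X' V)).symm]
      simp only [hΨ]
      abel)
  -- `Ψ V` determines the minimizer for `X`, which is `T X' V`; subtracting the shift then recovers
  -- `V`.
  have hinj : Set.InjOn Ψ (T X' ⁻¹' B ∩ D X') := fun V hV W hW hVW => by
    have hT : T X' W = T X' V := (hΨmin V hV.2).eq hn hγ0 hr hconv hg (hVW ▸ hΨmin W hW.2)
    have : V + g (X' i) (T X' V) - g (X i) (T X' V)
      = W + g (X' i) (T X' W) - g (X i) (T X' W) := hVW
    rw [hT] at this
    exact add_right_cancel (sub_left_inj.1 this)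
  have hder := fun V hV => hasFDerivWithinAt_noise_shift hn hγ0 hlam hr hconv hgH hrank heig
    (Measure.dense_of_ae (hD X')) (fun V hV => (hTD X' V hV).2.1) hV (hTD X' V hV).2.2.1
    (hTD X' V hV).2.2.2 i (X i)
  have hcov := kNormUnnormalized_le_image (K := K) ha.le (((hTc X').measurable hB).inter (hDm X'))
    hinj (fun V hV => (hder V hV.2).1.mono Set.inter_subset_right)
    (fun V hV => (hder V hV.2).2.trans (le_abs_self _)) (Δ := Δ) (fun V hV => by
      have hmove : Ψ V - V = g (X' i) (T X' V) - g (X i) (T X' V) := by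
        simp only [hΨ]
        abel
      exact hmove ▸ hsens _ _ _ (hTD X' V hV.2).2.1.1)
  have hconst : γ / (lam + γ) * Real.exp (-(a * Δ)) = Real.exp (-ε) := by
    have h1 : γ / (lam + γ) = Real.exp (-(ε * (1 - q))) := by
      rw [Real.exp_neg, hγ]
      have : Real.exp (ε * (1 - q)) - 1 ≠ 0 := by linarith
      field_simp
      ring
    rw [h1, ← Real.exp_add, ha_def, div_mul_cancel₀ _ hΔ.ne']
    congr 1
    ring
  rw [hconst] at hcov
  -- On `D X`, uniqueness gives `T X (Ψ V) = T X' V`, so the shifted noise also produces an output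
  -- in `B`.
  have hsub : Ψ '' (T X' ⁻¹' B ∩ D X') ∩ D X ⊆ T X ⁻¹' B ∩ D X := by
    rintro _ ⟨⟨V, hV, rfl⟩, hW⟩
    refine ⟨?_, hW⟩
    rw [Set.mem_preimage, (hΨmin V hV.2).eq hn hγ0 hr hconv hg (hTD X _ hW).2.1]
    exact hV.1
  have hfin := hcov.trans ((measure_inter_conull (hcac.ae_le (hD X))).ge.trans (measure_mono hsub))
  calc _ = ENNReal.ofReal (Real.exp ε) * (ENNReal.ofReal (Real.exp (-ε)) *
        kNormUnnormalized K a (T X' ⁻¹' B ∩ D X')) := by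
        rw [← mul_assoc, ← ENNReal.ofReal_mul (Real.exp_pos _).le, ← Real.exp_add]
        simp
    _ ≤ _ := by gcongr
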